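/- **Terms.** Simple types are built from one base type $0$ with $\to$. Let $\Sigma=\Sigma_0\cup\Sigma_2$ be a tree signature: the constants in $\Sigma_0$ have type $0$, those in $\Sigma_2$ have type $0\to 0\to 0$. The $\lambda Y$-terms over $\Sigma$ are the simply typed $\lambda$-terms built from typed variables, the constants of $\Sigma$ and, at every type $\alpha$, the constants $\omega^\alpha$, $\Omega^\alpha$ of type $\alpha$ and $Y$ of type $(\alpha\to\alpha)\to\alpha$. Reduction $\to^*_{\beta\delta}$ is generated by $(\lambda x.M)N\to M[N/x]$ and $YM\to M(YM)$, applied at any position. For a closed term $M$ of type $0$ without $\omega$, the Böhm tree $BT(M)$ is the possibly infinite binary tree given as follows: if $M\to^*_{\beta\delta}c$ with $c\in\Sigma_0$, it is the leaf $c$; if $M\to^*_{\beta\delta}b\,N_1N_2$ with $b\in\Sigma_2$, it has root $b$ and subtrees $BT(N_1)$, $BT(N_2)$; otherwise it is the leaf $\Omega$. **Automata.** An (insightful) TAC automaton $\mathcal A=\langle Q,\Sigma,q^0,\delta_0,\delta_2\rangle$ has a finite set $Q$ of states, an initial state $q^0\in Q$, and transition functions $\delta_0:Q\times(\Sigma_0\cup\{\Omega\})\to\{\mathrm{ff},\mathrm{tt}\}$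 and $\delta_2:Q\times\Sigma_2\to\mathcal P(Q^2)$; no restriction is put on $\delta_0(\cdot,\Omega)$. A run on a binary tree $t$ labels the nodes of $t$ by states, the root by $q^0$, such that the pair of states at the two children of an internal node $x$ lies in $\delta_2(r(x),t(x))$. It is accepting if $\delta_0(r(x),t(x))=\mathrm{tt}$ at every leaf $x$; infinite paths carry no condition. $L(\mathcal A)$ is the set of trees that have an accepting run. Put $Q_\Omega=\{q\in Q\mid \delta_0(q,\Omega)=\mathrm{tt}\}$. **The model.** Let $\mathcal D_0=\{\bot<\top\}$, let $\mathcal D_{\alpha\to\beta}$ be the lattice of all monotone functions $\mathcal D_\alpha\to\mathcal D_\beta$ with the pointwise order, and let $\mathrm{fix}_\alpha$ be the least fixpoint operator on $\mathcal D_{\alpha\to\alpha}$. Define ordered sets $\mathcal K_\alpha$ and relations $\mathcal L_\alpha\subseteq\mathcal K_\alpha\times\mathcal D_\alpha$ by $$\mathcal K_0=\{(\top,P)\mid P\subseteq Q\}\cup\{(\bot,Q_\Omega)\},\qquad \mathcal L_0=\{((d,P),d)\mid (d,P)\in\mathcal K_0\},$$ with the product order on $\mathcal K_0$, and $$\mathcal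 K_{\alpha\to\beta}=\{f:\mathcal K_\alpha\to\mathcal K_\beta\text{ monotone}\mid \exists d\in\mathcal D_{\alpha\to\beta}\ \forall (g,e)\in\mathcal L_\alpha:\ (f(g),d(e))\in\mathcal L_\beta\},$$ $$\mathcal L_{\alpha\to\beta}=\{(f,d)\in\mathcal K_{\alpha\to\beta}\times\mathcal D_{\alpha\to\beta}\mid \forall (g,e)\in\mathcal L_\alpha:\ (f(g),d(e))\in\mathcal L_\beta\},$$ with the pointwise order on $\mathcal K_{\alpha\to\beta}$. Every $p\in\mathcal K_\alpha$ is $\mathcal L_\alpha$-related to exactly one $\bar p\in\mathcal D_\alpha$, and for every $d\in\mathcal D_\alpha$ the set of elements related to $d$ has a greatest element $d^\uparrow$. For $f\in\mathcal K_{\alpha\to\alpha}$ put $\mathrm{Fix}_\alpha(f)=\bigwedge_{n\in\mathbb N}f^n\big(\mathrm{fix}_\alpha(\bar f)^\uparrow\big)$. The model $\mathcal K=\mathcal K(Q,Q_\Omega)$ interprets terms in the sets $\mathcal K_\alpha$ in the usual way, where $\omega^\alpha$ denotes the greatest element of $\mathcal K_\alpha$, $Y$ denotes $\mathrm{Fix}_\alpha$,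 $\Omega^0$ denotes $(\bot,Q_\Omega)$, $\Omega^{\alpha\to\beta}$ denotes the constant function whose value is the denotation of $\Omega^\beta$, and $$\rho(c)=(\top,\{q\mid\delta_0(q,c)=\mathrm{tt}\}),\qquad \rho(b)(d_1,R_1)(d_2,R_2)=(\top,\{q\mid\delta_2(q,b)\cap (R_1\times R_2)\neq\emptyset\})$$ for $c\in\Sigma_0$ and $b\in\Sigma_2$. **Theorem.** Let $\mathcal A$ be an insightful TAC automaton with set of states $Q$ and initial state $q^0$, let $Q_\Omega$ be the set of states from which it accepts $\Omega$, and let $\mathcal K=\mathcal K(Q,Q_\Omega)$ be the model above. Then every $\mathcal K_\alpha$ is finite, and for every closed $\lambda Y$-term $M$ of type $0$ without $\omega$, $$BT(M)\in L(\mathcal A)\quad\Longleftrightarrow\quad q^0\text{ lies in the second component of }[\![M]\!]_{\mathcal K}.$$ -/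

import Mathlib

namespace LambdaY

universe u v w

/-! ## Simply typed lambda-Y-terms over a tree signature -/

/-- Simple types over the single base type `0` (written `o`). -/
inductive Ty : Type
  | o : Ty
  | arr : Ty → Ty → Ty

/-- Typed de Bruijn variables: `Var Γ a` are the variables of type `a` in the context `Γ`. -/
inductive Var : List Ty → Ty → Type
  | zero {Γ : List Ty} {a : Ty} : Var (a :: Γ) a
  | succ {Γ : List Ty} {a b : Ty} : Var Γ a → Var (b :: Γ) a

/-- Simply typed terms (up to renaming of bound variables) with free variables in the context `Γ`,
over the tree signature with constants `S0` of type `0` and `S2` of type `0 → 0 → 0`.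
At every type there are the constants `ω` (`undef`), `Ω` (`div`), and the fixpoint constant
`Y` (`fix`). Closed terms are the terms in the empty context. -/
inductive Term (S0 : Type u) (S2 : Type v) : List Ty → Ty → Type (max u v)
  | var {Γ : List Ty} {a : Ty} : Var Γ a → Term S0 S2 Γ a
  | app {Γ : List Ty} {a b : Ty} : Term S0 S2 Γ (.arr a b) → Term S0 S2 Γ a → Term S0 S2 Γ b
  | lam {Γ : List Ty} {a b : Ty} : Term S0 S2 (a :: Γ) b → Term S0 S2 Γ (.arr a b)
  | leaf {Γ : List Ty} (c : S0) : Term S0 S2 Γ .o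
  | node {Γ : List Ty} (c : S2) : Term S0 S2 Γ (.arr .o (.arr .o .o))
  | undef {Γ : List Ty} (a : Ty) : Term S0 S2 Γ a
  | div {Γ : List Ty} (a : Ty) : Term S0 S2 Γ a
  | fix {Γ : List Ty} (a : Ty) : Term S0 S2 Γ (.arr (.arr a a) a)

section Terms

variable {S0 : Type u} {S2 : Type v}

/-- Lifting of a renaming under a binder. -/
def liftRen {Γ Δ : List Ty} (r : ∀ a, Var Γ a → Var Δ a) (b : Ty) :
    ∀ a, Var (b :: Γ) a → Var (b :: Δ) a
  | _, .zero => .zero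
  | _, .succ x => .succ (r _ x)

/-- Renaming of free variables. -/
def Term.rename : {Γ Δ : List Ty} → {a : Ty} → (∀ a, Var Γ a → Var Δ a) →
    Term S0 S2 Γ a → Term S0 S2 Δ a
  | _, _, _, r, .var x => .var (r _ x)
  | _, _, _, r, .app M N => .app (M.rename r) (N.rename r)
  | _, _, _, r, .lam M => .lam (M.rename (liftRen r _))
  | _, _, _, _, .leaf c => .leaf c
  | _, _, _, _, .node c => .node c
  | _, _, _, _, .undef a => .undef a
  | _, _, _, _, .div a => .div a
  | _, _, _, _, .fix a => .fix a

/-- Lifting of a substitution under a binder. -/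
def liftSubst {Γ Δ : List Ty} (s : ∀ a, Var Γ a → Term S0 S2 Δ a) (b : Ty) :
    ∀ a, Var (b :: Γ) a → Term S0 S2 (b :: Δ) a
  | _, .zero => .var .zero
  | _, .succ x => (s _ x).rename (fun _ y => .succ y)

/-- Simultaneous capture-avoiding substitution. -/
def Term.subst : {Γ Δ : List Ty} → {a : Ty} → (∀ a, Var Γ a → Term S0 S2 Δ a) →
    Term S0 S2 Γ a → Term S0 S2 Δ a
  | _, _, _, s, .var x => s _ x
  | _, _, _, s, .app M N => .app (M.subst s) (N.subst s)
  | _, _, _, s, .lam M => .lam (M.subst (liftSubst s _))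
  | _, _, _, _, .leaf c => .leaf c
  | _, _, _, _, .node c => .node c
  | _, _, _, _, .undef a => .undef a
  | _, _, _, _, .div a => .div a
  | _, _, _, _, .fix a => .fix a

/-- The substitution of `N` for the most recently bound variable. -/
def instSubst {Γ : List Ty} {b : Ty} (N : Term S0 S2 Γ b) :
    ∀ a, Var (b :: Γ) a → Term S0 S2 Γ a
  | _, .zero => N
  | _, .succ x => .var x

/-- One step of beta-delta-contraction, at any position of the term. -/
inductive Step : {Γ : List Ty} → {a : Ty} → Term S0 S2 Γ a → Term S0 S2 Γ a → Prop
  | beta {Γ : List Ty} {a b : Ty} (M : Term S0 S2 (a :: Γ) b) (N : Term S0 S2 Γ a) :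
      Step (.app (.lam M) N) (M.subst (instSubst N))
  | delta {Γ : List Ty} {a : Ty} (M : Term S0 S2 Γ (.arr a a)) :
      Step (.app (.fix a) M) (.app M (.app (.fix a) M))
  | appLeft {Γ : List Ty} {a b : Ty} {M M' : Term S0 S2 Γ (.arr a b)} (N : Term S0 S2 Γ a) :
      Step M M' → Step (.app M N) (.app M' N)
  | appRight {Γ : List Ty} {a b : Ty} (M : Term S0 S2 Γ (.arr a b)) {N N' : Term S0 S2 Γ a} :
      Step N N' → Step (.app M N) (.app M N')
  | lam {Γ : List Ty} {a b : Ty} {M M' : Term S0 S2 (a :: Γ) b} :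
      Step M M' → Step (.lam M) (.lam M')

/-- Beta-delta-reduction. -/
def Reduces {Γ : List Ty} {a : Ty} (M N : Term S0 S2 Γ a) : Prop :=
  Relation.ReflTransGen Step M N

/-- The constants `ω` (of any type) do not occur in the term. -/
def Term.UndefFree : {Γ : List Ty} → {a : Ty} → Term S0 S2 Γ a → Prop
  | _, _, .app M N => M.UndefFree ∧ N.UndefFree
  | _, _, .lam M => M.UndefFree
  | _, _, .undef _ => False
  | _, _, .var _ => True
  | _, _, .leaf _ => True
  | _, _, .node _ => True
  | _, _, .div _ => True
  | _, _, .fix _ => True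

end Terms

/-! ## Binary trees and Böhm trees -/

/-- The two directions `1` and `2`; addresses of nodes are words over them. -/
inductive Dir : Type
  | one : Dir
  | two : Dir

/-- Labels in `S0 ∪ {Ω} ∪ S2`: `leaf (some c)` is `c : S0`, and `leaf none` is `Ω`. -/
inductive Label (S0 : Type u) (S2 : Type v) : Type (max u v)
  | leaf : Option S0 → Label S0 S2
  | node : S2 → Label S0 S2

/-- Partial functions from addresses to labels. -/
abbrev PTree (S0 : Type u) (S2 : Type v) : Type (max u v) := List Dir → Option (Label S0 S2)

/-- `t` is a possibly infinite (nonempty) binary tree. -/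
structure IsTree {S0 : Type u} {S2 : Type v} (t : PTree S0 S2) : Prop where
  root : (t []).isSome
  prefixClosed : ∀ x y, (t (x ++ y)).isSome → (t x).isSome
  children : ∀ x c, t x = some (.node c) → ∀ i : Dir, (t (x ++ [i])).isSome
  leaves : ∀ x c, t x = some (.leaf c) → ∀ y, (t (x ++ y)).isSome → y = []

section Bohm

variable {S0 : Type u} {S2 : Type v}

/-- The shapes `c` and `b N₁ N₂` of a closed head normal form of type `0` whose head is a
constant of the signature. -/
inductive Hnf (S0 : Type u) (S2 : Type v) : Type (max u v)
  | leaf (c : S0) : Hnf S0 S2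
  | node (c : S2) (N₁ N₂ : Term S0 S2 [] .o) : Hnf S0 S2

/-- A head normal form as a term. -/
def Hnf.toTerm : Hnf S0 S2 → Term S0 S2 [] .o
  | .leaf c => .leaf c
  | .node c N₁ N₂ => .app (.app (.node c) N₁) N₂

open Classical in
/-- Some head normal form, with a constant of the signature as head, to which the closed term `M`
of type `0` reduces, if there is any. (All of them have the same head, and their arguments are
pairwise convertible, because the reduction is confluent.) -/
noncomputable def hnf (M : Term S0 S2 [] .o) : Option (Hnf S0 S2) :=
  if h : ∃ H : Hnf S0 S2, Reduces M H.toTerm then some h.choose else none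

/-- The Böhm tree of a closed term `M` of type `0` without `ω`: if `M` reduces to `c`, it is the
leaf `c`; if `M` reduces to `b N₁ N₂`, it has the root `b` and the subtrees `BT(N₁)` and `BT(N₂)`;
otherwise it is the leaf `Ω`. (The last case comprises the terms without a head normal form and
those that reduce to `Ω N₁ … Nₖ`.) -/
noncomputable def bohmTree : Term S0 S2 [] .o → PTree S0 S2
  | M, [] =>
    match hnf M with
    | some (.leaf c) => some (.leaf (some c))
    | some (.node c _ _) => some (.node c)
    | none => some (.leaf none)
  | M, .one :: x =>
    match hnf M with
    | some (.node _ N₁ _) => bohmTree N₁ x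
    | _ => none
  | M, .two :: x =>
    match hnf M with
    | some (.node _ _ N₂) => bohmTree N₂ x
    | _ => none
termination_by _ x => x.length

end Bohm

/-! ## TAC automata -/

/-- Tree automata with trivial acceptance conditions, with no restriction on the behaviour
on `Ω`. In `leafOk`, the argument `none` stands for `Ω`. -/
structure TAC (S0 : Type u) (S2 : Type v) (Q : Type w) where
  init : Q
  leafOk : Q → Option S0 → Bool
  trans : Q → S2 → Set (Q × Q)

namespace TAC

variable {S0 : Type u} {S2 : Type v} {Q : Type w}

/-- `r` is a run of `A` on `t`. -/
structure IsRun (A : TAC S0 S2 Q) (t : PTree S0 S2) (r : List Dir → Option Q) : Prop where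
  domain : ∀ x, (r x).isSome ↔ (t x).isSome
  init : r [] = some A.init
  step : ∀ x c q q₁ q₂, t x = some (.node c) → r x = some q → r (x ++ [.one]) = some q₁ →
    r (x ++ [.two]) = some q₂ → (q₁, q₂) ∈ A.trans q c

/-- The run `r` is accepting. -/
def Accepting (A : TAC S0 S2 Q) (t : PTree S0 S2) (r : List Dir → Option Q) : Prop :=
  ∀ x c q, t x = some (.leaf c) → r x = some q → A.leafOk q c = true

/-- The language of `A`: the trees that have an accepting run. -/
def language (A : TAC S0 S2 Q) : Set (PTree S0 S2) :=
  {t | IsTree t ∧ ∃ r, A.IsRun t r ∧ A.Accepting t r}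

/-- The set of states from which `A` accepts `Ω`. -/
def divStates (A : TAC S0 S2 Q) : Set Q := {q | A.leafOk q none = true}

end TAC

/-! ## The applicative structures `K` and `D` and the logical relation `L` -/

/-- What is defined at a type by the simultaneous recursion: the ordered set `K`, the lattice `D`,
and the relation `L` between them. -/
structure Stage : Type (u + 1) where
  K : Type u
  D : Type
  [ordK : PartialOrder K]
  [latD : CompleteLattice D]
  L : K → D → Prop

attribute [instance] Stage.ordK Stage.latD

/-- The base type: `K₀ = {(⊤, P) | P ⊆ Q} ∪ {(⊥, W)}` with the product order, `D₀ = {⊥, ⊤}`, and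
`L₀ = {((d, P), d)}`. -/
noncomputable def Stage.base {Q : Type u} (W : Set Q) : Stage.{u} where
  K := {x : Bool × Set Q // x.1 = ⊤ ∨ x = (⊥, W)}
  D := Bool
  L := fun x d => x.1.1 = d

/-- Function types: `D` consists of all monotone functions, and `K` of the monotone functions that
some `d` in `D` tracks along `L`, both ordered pointwise. -/
noncomputable def Stage.arr (S T : Stage.{u}) : Stage.{u} where
  K := {f : S.K →o T.K // ∃ d : S.D →o T.D, ∀ g e, S.L g e → T.L (f g) (d e)}
  D := S.D →o T.D
  L := fun f d => ∀ g e, S.L g e → T.L (f.1 g) (d e)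

/-- The structure at every type, for a set `Q` and a subset `W`. -/
noncomputable def stage {Q : Type u} (W : Set Q) : Ty → Stage.{u}
  | .o => .base W
  | .arr a b => .arr (stage W a) (stage W b)

section Model

variable {Q : Type u} (W : Set Q)

/-- The ordered set `K_a`. -/
abbrev K (a : Ty) : Type u := (stage W a).K

/-- The lattice `D_a` of the model that detects divergence. -/
abbrev D (a : Ty) : Type := (stage W a).D

/-- The logical relation `L_a ⊆ K_a × D_a`. -/
abbrev L {a : Ty} (p : K W a) (d : D W a) : Prop := (stage W a).L p d

/-- The state set of an element of `K₀`. -/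
noncomputable def second (p : K W .o) : Set Q :=
  (show {x : Bool × Set Q // x.1 = ⊤ ∨ x = (⊥, W)} from p).1.2

/-- Application in `K`. -/
noncomputable def ap {a b : Ty} (f : K W (.arr a b)) : K W a → K W b :=
  (show (Stage.arr (stage W a) (stage W b)).K from f).1

/-- An element of `D_{a → b}` as a monotone function. -/
noncomputable def dhom {a b : Ty} (d : D W (.arr a b)) : D W a →o D W b := d

/-- The element of `K_{a → b}` given by a tracked monotone function. -/
noncomputable def mkK {a b : Ty} (f : K W a → K W b) (hf : Monotone f)
    (h : ∃ d : D W a →o D W b, ∀ g e, L W g e → L W (f g) (d e)) : K W (.arr a b) :=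
  show (Stage.arr (stage W a) (stage W b)).K from ⟨⟨f, hf⟩, h⟩

theorem ap_mono {a b : Ty} (f : K W (.arr a b)) : Monotone (ap W f) :=
  (show (Stage.arr (stage W a) (stage W b)).K from f).1.2

theorem ap_le {a b : Ty} {f g : K W (.arr a b)} (h : f ≤ g) (p : K W a) : ap W f p ≤ ap W g p :=
  h p

/-- Facts that hold at every type and that the interpretation of the constants needs. -/
structure Good (a : Ty) : Prop where
  total : ∀ p : K W a, ∃ d, L W p d
  mono : ∀ (p q : K W a) (d e : D W a), L W p d → L W q e → p ≤ q → d ≤ e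
  greatest : ∀ d : D W a, ∃ p, IsGreatest {q : K W a | L W q d} p
  greatest_mono : ∀ (d e : D W a) (p q : K W a), d ≤ e → L W p d →
    IsGreatest {q : K W a | L W q e} q → p ≤ q

theorem good : ∀ a : Ty, Good W a
  | .o => by
    have key : ∀ (d e : Bool) (p q : {x : Bool × Set Q // x.1 = ⊤ ∨ x = (⊥, W)}), d ≤ e →
        p.1.1 = d → q.1.1 = e → (e = ⊤ → q.1.2 = Set.univ) → p ≤ q := by
      rintro d e ⟨⟨p1, p2⟩, hp⟩ ⟨⟨q1, q2⟩, hq⟩ hde hpd hqe hu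
      refine ⟨hpd.trans_le (hde.trans hqe.ge), ?_⟩
      simp only at hpd hqe hu hp hq ⊢
      subst hpd hqe
      cases q1
      · cases p1
        · simp at hp hq
          simp [hp, hq]
        · exact absurd hde (by decide)
      · rw [hu rfl]
        exact Set.subset_univ _
    have ex : ∀ d : Bool, ∃ p : {x : Bool × Set Q // x.1 = ⊤ ∨ x = (⊥, W)},
        p.1.1 = d ∧ (d = ⊤ → p.1.2 = Set.univ) := by
      intro d
      cases d
      · exact ⟨⟨(⊥, W), Or.inr rfl⟩, rfl, fun h => absurd h (by decide)⟩
      · exact ⟨⟨(⊤, Set.univ), Or.inl rfl⟩, rfl, fun _ => rfl⟩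
    refine ⟨fun p => ⟨_, rfl⟩, ?_, ?_, ?_⟩
    · rintro p q d e rfl rfl h
      exact h.1
    · intro d
      obtain ⟨p, hp, hu⟩ := ex d
      exact ⟨p, hp, fun q hq => key d d q p le_rfl hq hp hu⟩
    · intro d e p q hde hp hq
      obtain ⟨q', hq', hu⟩ := ex e
      exact le_trans (key d e p q' hde hp hq' hu) (hq.2 hq')
  | .arr a b => by
    have ga := good a
    have gb := good b
    choose bar hbar using ga.total
    choose up hup using gb.greatest
    have bar_eq : ∀ p e, L W p e → bar p = e := fun p e h =>
      le_antisymm (ga.mono _ _ _ _ (hbar p) h le_rfl) (ga.mono _ _ _ _ h (hbar p) le_rfl)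
    have ex : ∀ d : D W (.arr a b), ∃ p : K W (.arr a b), L W p d ∧
        ∀ x, ap W p x = up (dhom W d (bar x)) := by
      intro d
      have hL : ∀ g e, L W g e → L W (up (dhom W d (bar g))) (dhom W d e) := by
        intro g e h
        rw [bar_eq g e h]
        exact (hup _).1
      refine ⟨mkK W (fun x => up (dhom W d (bar x))) ?_ ⟨dhom W d, hL⟩, hL, fun x => rfl⟩
      intro x y hxy
      exact gb.greatest_mono _ _ _ _
        ((dhom W d).monotone (ga.mono _ _ _ _ (hbar x) (hbar y) hxy)) (hup _).1 (hup _)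
    have key : ∀ (d e : D W (.arr a b)) (p q : K W (.arr a b)), d ≤ e → L W p d →
        (∀ x, ap W q x = up (dhom W e (bar x))) → p ≤ q := by
      intro d e p q hde hp hq x
      change ap W p x ≤ ap W q x
      rw [hq x]
      exact gb.greatest_mono _ _ _ _ (hde (bar x)) (hp _ _ (hbar x)) (hup _)
    refine ⟨?_, ?_, ?_, ?_⟩
    · intro p
      exact (show (Stage.arr (stage W a) (stage W b)).K from p).2
    · intro p q d e hp hq h x
      obtain ⟨y, hy⟩ := ga.greatest x
      exact gb.mono _ _ _ _ (hp y x hy.1) (hq y x hy.1) (h y)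
    · intro d
      obtain ⟨p, hp, hu⟩ := ex d
      exact ⟨p, hp, fun q hq => key d d q p le_rfl hq hu⟩
    · intro d e p q hde hp hq
      obtain ⟨q', hq', hu⟩ := ex e
      exact le_trans (key d e p q' hde hp hu) (hq.2 hq')

/-- The projection `p ↦ p̄` of `K_a` to `D_a`: the element related to `p`. -/
noncomputable def bar {a : Ty} (p : K W a) : D W a := ((good W a).total p).choose

/-- The embedding `d ↦ d↑` of `D_a` into `K_a`: the join of the elements related to `d`, which is
the greatest of them. -/
noncomputable def up {a : Ty} (d : D W a) : K W a := ((good W a).greatest d).choose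

theorem bar_spec {a : Ty} (p : K W a) : L W p (bar W p) := ((good W a).total p).choose_spec

theorem up_spec {a : Ty} (d : D W a) : IsGreatest {p : K W a | L W p d} (up W d) :=
  ((good W a).greatest d).choose_spec

theorem up_rel {a : Ty} (d : D W a) : L W (up W d) d := (up_spec W d).1

theorem bar_mono {a : Ty} {p q : K W a} (h : p ≤ q) : bar W p ≤ bar W q :=
  (good W a).mono _ _ _ _ (bar_spec W p) (bar_spec W q) h

theorem bar_eq {a : Ty} {p : K W a} {d : D W a} (h : L W p d) : bar W p = d :=
  le_antisymm ((good W a).mono _ _ _ _ (bar_spec W p) h le_rfl)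
    ((good W a).mono _ _ _ _ h (bar_spec W p) le_rfl)

theorem le_up {a : Ty} {p : K W a} {d e : D W a} (h : L W p d) (hde : d ≤ e) : p ≤ up W e :=
  (good W a).greatest_mono _ _ _ _ hde h (up_spec W e)

theorem ap_rel {a b : Ty} {f : K W (.arr a b)} {d : D W (.arr a b)} (h : L W f d) {p : K W a}
    {e : D W a} (hp : L W p e) : L W (ap W f p) (dhom W d e) :=
  h p e hp

theorem exists_isGreatest (a : Ty) : ∃ p : K W a, ∀ q, q ≤ p :=
  ⟨up W ⊤, fun q => le_up W (bar_spec W q) le_top⟩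

/-- The greatest element of `K_a`. -/
noncomputable def ttop (a : Ty) : K W a := (exists_isGreatest W a).choose

theorem le_ttop {a : Ty} (p : K W a) : p ≤ ttop W a := (exists_isGreatest W a).choose_spec p

/-- Constant functions belong to `K`. -/
noncomputable def constK (a : Ty) {b : Ty} (p : K W b) : K W (.arr a b) :=
  mkK W (fun _ => p) (fun _ _ _ => le_rfl) ⟨⟨fun _ => bar W p, fun _ _ _ => le_rfl⟩,
    fun _ _ _ => bar_spec W p⟩

/-- The interpretation of `Ω`: `(⊥, W)` at the base type, and constant functions above. -/
noncomputable def bbot : (a : Ty) → K W a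
  | .o => show {x : Bool × Set Q // x.1 = ⊤ ∨ x = (⊥, W)} from ⟨(⊥, W), Or.inr rfl⟩
  | .arr a b => constK W a (bbot b)

instance K_finite [Finite Q] : (a : Ty) → Finite (K W a)
  | .o => inferInstanceAs (Finite {x : Bool × Set Q // x.1 = ⊤ ∨ x = (⊥, W)})
  | .arr a b => by
    have := K_finite a
    have := K_finite b
    exact Finite.of_injective (fun f : K W (.arr a b) => ap W f)
      (fun f g h => Subtype.ext (OrderHom.ext _ _ h))

/-! ## Fixpoints -/

/-- The least fixpoint operator of `D`. -/
noncomputable def dfix {a : Ty} (d : D W (.arr a a)) : D W a := (dhom W d).lfp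

/-- The sequence `fⁿ(fix(f̄)↑)`. -/
noncomputable def iter {a : Ty} (f : K W (.arr a a)) (n : ℕ) : K W a :=
  (ap W f)^[n] (up W (dfix W (bar W f)))

theorem iter_succ {a : Ty} (f : K W (.arr a a)) (n : ℕ) :
    iter W f (n + 1) = ap W f (iter W f n) :=
  Function.iterate_succ_apply' _ _ _

theorem iter_rel {a : Ty} (f : K W (.arr a a)) (n : ℕ) :
    L W (iter W f n) (dfix W (bar W f)) := by
  induction n with
  | zero => exact up_rel W _
  | succ n ih =>
    rw [iter_succ]
    have h := ap_rel W (bar_spec W f) ih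
    rwa [show dhom W (bar W f) (dfix W (bar W f)) = dfix W (bar W f) from
      OrderHom.map_lfp _] at h

theorem iter_antitone {a : Ty} (f : K W (.arr a a)) : Antitone (iter W f) := by
  refine antitone_nat_of_succ_le fun n => ?_
  induction n with
  | zero => exact (up_spec W _).2 (iter_rel W f 1)
  | succ n ih =>
    rw [iter_succ W f (n + 1), iter_succ W f n]
    exact ap_mono W f (by rwa [← iter_succ])

theorem iter_mono {a : Ty} {f g : K W (.arr a a)} (h : f ≤ g) (n : ℕ) :
    iter W f n ≤ iter W g n := by
  induction n with
  | zero => exact le_up W (up_rel W _) (OrderHom.lfp.monotone (bar_mono W h))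
  | succ n ih =>
    rw [iter_succ, iter_succ]
    exact (ap_mono W f ih).trans (ap_le W h _)

variable [Finite Q]

theorem exists_isGLB_iter {a : Ty} (f : K W (.arr a a)) :
    ∃ n, IsGLB (Set.range (iter W f)) (iter W f n) := by
  obtain ⟨n, hn⟩ := WellFoundedLT.antitone_chain_condition (iter_antitone W f)
  refine ⟨n, ?_, fun p hp => hp ⟨n, rfl⟩⟩
  rintro _ ⟨m, rfl⟩
  rcases le_total n m with h | h
  · exact (hn m h).le
  · exact iter_antitone W f h

/-- `Fix(f) = ⋀ₙ fⁿ(fix(f̄)↑)`. -/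
noncomputable def fixpt {a : Ty} (f : K W (.arr a a)) : K W a :=
  iter W f (exists_isGLB_iter W f).choose

theorem fixpt_isGLB {a : Ty} (f : K W (.arr a a)) :
    IsGLB (Set.range (iter W f)) (fixpt W f) :=
  (exists_isGLB_iter W f).choose_spec

theorem fixpt_mono {a : Ty} : Monotone (fixpt W (a := a)) := by
  intro f g h
  refine (fixpt_isGLB W g).2 ?_
  rintro _ ⟨n, rfl⟩
  exact ((fixpt_isGLB W f).1 ⟨n, rfl⟩).trans (iter_mono W h n)

/-- The operator `Fix` as an element of `K`. -/
noncomputable def fixK (a : Ty) : K W (.arr (.arr a a) a) :=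
  mkK W (fixpt W) (fixpt_mono W) ⟨OrderHom.lfp, fun f d h => by
    have := iter_rel W f (exists_isGLB_iter W f).choose
    rwa [bar_eq W h] at this⟩

/-! ## Interpretation of terms -/

/-- Valuations in `K` of the variables of a context. -/
abbrev Env (Γ : List Ty) : Type u := ∀ a, Var Γ a → K W a

/-- Valuations in `D` of the variables of a context. -/
abbrev DEnv (Γ : List Ty) : Type := ∀ a, Var Γ a → D W a

/-- Extension of a valuation, sending the most recently bound variable to `p`. -/
def Env.cons {W : Set Q} {Γ : List Ty} {b : Ty} (p : K W b) (v : Env W Γ) : Env W (b :: Γ)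
  | _, .zero => p
  | _, .succ x => v _ x

/-- Extension of a valuation in `D`. -/
def DEnv.cons {W : Set Q} {Γ : List Ty} {b : Ty} (p : D W b) (v : DEnv W Γ) : DEnv W (b :: Γ)
  | _, .zero => p
  | _, .succ x => v _ x

/-- The functions from valuations to `K_a` in which terms are interpreted: the monotone ones that
are tracked by a monotone function from valuations in `D` to `D_a`. This is what makes a
lambda-abstraction define an element of `K`. -/
structure Den (Γ : List Ty) (a : Ty) : Type u where
  toFun : Env W Γ → K W a
  mono : ∀ v v' : Env W Γ, (∀ a x, v a x ≤ v' a x) → toFun v ≤ toFun v'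
  tracked : ∃ ψ : DEnv W Γ → D W a, (∀ e e' : DEnv W Γ, (∀ a x, e a x ≤ e' a x) → ψ e ≤ ψ e') ∧
    ∀ (v : Env W Γ) (e : DEnv W Γ), (∀ a x, L W (v a x) (e a x)) → L W (toFun v) (ψ e)

/-- The interpretation of a constant. -/
noncomputable def Den.const {W : Set Q} {Γ : List Ty} {a : Ty} (p : K W a) : Den W Γ a where
  toFun := fun _ => p
  mono := fun _ _ _ => le_rfl
  tracked := ⟨fun _ => bar W p, fun _ _ _ => le_rfl, fun _ _ _ => bar_spec W p⟩

/-- The interpretation of a variable. -/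
noncomputable def Den.var {W : Set Q} {Γ : List Ty} {a : Ty} (x : Var Γ a) : Den W Γ a where
  toFun := fun v => v a x
  mono := fun _ _ h => h a x
  tracked := ⟨fun e => e a x, fun _ _ h => h a x, fun _ _ h => h a x⟩

/-- The interpretation of an application. -/
noncomputable def Den.app {W : Set Q} {Γ : List Ty} {a b : Ty} (F : Den W Γ (.arr a b)) (G : Den W Γ a) :
    Den W Γ b where
  toFun := fun v => ap W (F.toFun v) (G.toFun v)
  mono := fun v v' h => (ap_mono W _ (G.mono v v' h)).trans (ap_le W (F.mono v v' h) _)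
  tracked := by
    obtain ⟨f, hf, hF⟩ := F.tracked
    obtain ⟨g, hg, hG⟩ := G.tracked
    refine ⟨fun e => dhom W (f e) (g e), fun e e' h => ?_, fun v e h => ?_⟩
    · exact ((dhom W (f e)).monotone (hg e e' h)).trans (hf e e' h (g e'))
    · exact ap_rel W (hF v e h) (hG v e h)

/-- The interpretation of a lambda-abstraction: the element `p ↦ F(v[p/x])` of `K_{a → b}`. -/
noncomputable def Den.lam {W : Set Q} {Γ : List Ty} {a b : Ty} (F : Den W (a :: Γ) b) :
    Den W Γ (.arr a b) where
  toFun := fun v => mkK W (fun p => F.toFun (v.cons p))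
    (fun p p' h => F.mono _ _ (by rintro c (_ | x); exacts [h, le_rfl]))
    (by
      obtain ⟨f, hf, hF⟩ := F.tracked
      refine ⟨⟨fun d => f (DEnv.cons d (fun c x => bar W (v c x))), fun d d' h => ?_⟩,
        fun p d h => hF _ _ ?_⟩
      · exact hf _ _ (by rintro c (_ | x); exacts [h, le_rfl])
      · rintro c (_ | x)
        exacts [h, bar_spec W _])
  mono := fun v v' h p => F.mono _ _ (by rintro c (_ | x); exacts [le_rfl, h _ _])
  tracked := by
    obtain ⟨f, hf, hF⟩ := F.tracked
    refine ⟨fun e => (⟨fun d => f (DEnv.cons d e), fun d d' h => ?_⟩ : D W a →o D W b),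
      fun e e' h d => ?_, fun v e h p d hp => hF _ _ ?_⟩
    · exact hf _ _ (by rintro c (_ | x); exacts [h, le_rfl])
    · exact hf _ _ (by rintro c (_ | x); exacts [le_rfl, h _ _])
    · rintro c (_ | x)
      exacts [hp, h _ _]

/-- The interpretation of terms in the model `K(Q, W, ρ)`, where the valuation `ρ` is given by
`ρ₀` on the constants of type `0` and by `ρ₂` on those of type `0 → 0 → 0`. -/
noncomputable def interp {S0 : Type v} {S2 : Type w} (ρ₀ : S0 → K W .o)
    (ρ₂ : S2 → K W (.arr .o (.arr .o .o))) : {Γ : List Ty} → {a : Ty} → Term S0 S2 Γ a → Den W Γ a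
  | _, _, .var x => .var x
  | _, _, .app M N => .app (interp ρ₀ ρ₂ M) (interp ρ₀ ρ₂ N)
  | _, _, .lam M => .lam (interp ρ₀ ρ₂ M)
  | _, _, .leaf c => .const (ρ₀ c)
  | _, _, .node c => .const (ρ₂ c)
  | _, _, .undef a => .const (ttop W a)
  | _, _, .div a => .const (bbot W a)
  | _, _, .fix a => .const (fixK W a)

/-- The element `(⊤, P)` of `K₀`. -/
noncomputable def topPair (P : Set Q) : K W .o :=
  show {x : Bool × Set Q // x.1 = ⊤ ∨ x = (⊥, W)} from ⟨(⊤, P), Or.inl rfl⟩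

/-- The element of `K_{0 → 0 → 0}` that maps `(d₁, R₁)` and `(d₂, R₂)` to
`(⊤, {q | T q ∩ R₁ × R₂ ≠ ∅})`. -/
noncomputable def nodeK (T : Q → Set (Q × Q)) : K W (.arr .o (.arr .o .o)) :=
  have hm : ∀ p p' r r' : K W .o, p ≤ p' → r ≤ r' →
      topPair W {q | (T q ∩ second W p ×ˢ second W r).Nonempty} ≤
        topPair W {q | (T q ∩ second W p' ×ˢ second W r').Nonempty} := fun _ _ _ _ h h' =>
    ⟨le_rfl, fun _ hq => hq.mono (Set.inter_subset_inter_right _ (Set.prod_mono h.2 h'.2))⟩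
  mkK W (fun p => mkK W (fun r => topPair W {q | (T q ∩ second W p ×ˢ second W r).Nonempty})
      (fun r r' h => hm p p r r' le_rfl h) ⟨⟨fun _ => ⊤, fun _ _ _ => le_rfl⟩, fun _ _ _ => rfl⟩)
    (fun p p' h r => hm p p' r r h le_rfl)
    ⟨⟨fun _ => (⟨fun _ => ⊤, fun _ _ _ => le_rfl⟩ : D W .o →o D W .o), fun _ _ _ => le_rfl⟩,
      fun _ _ _ _ _ _ => rfl⟩

end Model

/-- The value of a closed term in the model `K(Q, Q_Ω)` of an automaton, where `Q_Ω` is the set of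
states from which the automaton accepts `Ω`, where `ρ(c) = (⊤, {q | A accepts c from q})` for
`c : 0`, and where `ρ(b)` is given by the transitions on `b` for `b : 0 → 0 → 0`. -/
noncomputable def TAC.value {S0 : Type v} {S2 : Type w} {Q : Type u} [Finite Q]
    (A : TAC S0 S2 Q) {a : Ty} (M : Term S0 S2 [] a) : K A.divStates a :=
  (interp A.divStates (fun c => topPair _ {q | A.leafOk q (some c) = true})
    (fun c => nodeK _ (fun q => A.trans q c)) M).toFun (fun _ x => nomatch x)

end LambdaY

/-!
The automaton is compared with the model `K` through a third model of the calculus, the *tree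
model*: at the base type it has all sets of labelled addresses, at function types all monotone
functions, and `Y` is the least fixpoint operator. Its constructors `treeLeaf` and `treeNode` are
injective and have disjoint ranges, so the value of a closed term of type `0` describes its Böhm
tree, whatever head normal form is chosen at each node; this replaces the confluence of reduction.

* Values in `K` and in the tree model are invariant under reduction (`TermModel.val_reduces`).
* Adequacy (`exists_hnf_of_treeVal_nonempty`): a closed term of type `0` with a nonempty value in
  the tree model reduces to a head normal form. The proof uses a logical relation between the tree
  model and closed terms, which is closed under suprema and so passes to least fixpoints.
* A second logical relation, `Covers`, between the tree model and `K` says at the base type that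
  `(d, P)` satisfies `d = ⊤` exactly if the tree is nonempty, and that `P` contains all states from
  which the tree is accepted. It is preserved by `Fix`: the start `fix(f̄)↑` of the iteration covers
  the least fixpoint in the tree model because it is greatest over its projection to `D`, and each
  application of `f` preserves this. Hence acceptance implies membership in the value in `K`.

For the converse, invariance under reduction and `Covers` show that the state set of the value of
`M` satisfies the equation prescribed by the head normal form of `M`, and that it is `Q_Ω` if there
is none. A run from any state of that set is then built downwards along the Böhm tree.
-/

namespace LambdaY

universe u v w

/-! ### Substitution -/

section Substitution

variable {S0 : Type u} {S2 : Type v}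

theorem liftRen_comp {Γ Δ Θ : List Ty} (r : ∀ a, Var Γ a → Var Δ a) (r' : ∀ a, Var Δ a → Var Θ a)
    (b : Ty) : (fun a x => liftRen r' b a (liftRen r b a x)) =
      liftRen (fun a x => r' a (r a x)) b := by
  funext a x
  cases x <;> rfl

theorem Term.rename_rename {Γ : List Ty} {a : Ty} (M : Term S0 S2 Γ a) :
    ∀ {Δ Θ : List Ty} (r : ∀ a, Var Γ a → Var Δ a) (r' : ∀ a, Var Δ a → Var Θ a),
      (M.rename r).rename r' = M.rename (fun a x => r' a (r a x)) := by
  induction M with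
  | app M N ihM ihN => intro Δ Θ r r'; simp only [Term.rename, ihM, ihN]
  | lam M ih => intro Δ Θ r r'; simp only [Term.rename, ih, liftRen_comp]
  | _ => intros; rfl

theorem liftSubst_liftRen {Γ Δ Θ : List Ty} (r : ∀ a, Var Γ a → Var Δ a)
    (s : ∀ a, Var Δ a → Term S0 S2 Θ a) (b : Ty) :
    (fun a x => liftSubst s b a (liftRen r b a x)) = liftSubst (fun a x => s a (r a x)) b := by
  funext a x
  cases x <;> rfl

theorem Term.subst_rename {Γ : List Ty} {a : Ty} (M : Term S0 S2 Γ a) :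
    ∀ {Δ Θ : List Ty} (r : ∀ a, Var Γ a → Var Δ a) (s : ∀ a, Var Δ a → Term S0 S2 Θ a),
      (M.rename r).subst s = M.subst (fun a x => s a (r a x)) := by
  induction M with
  | app M N ihM ihN => intro Δ Θ r s; simp only [Term.rename, Term.subst, ihM, ihN]
  | lam M ih => intro Δ Θ r s; simp only [Term.rename, Term.subst, ih, liftSubst_liftRen]
  | _ => intros; rfl

theorem rename_liftSubst {Γ Δ Θ : List Ty} (s : ∀ a, Var Γ a → Term S0 S2 Δ a)
    (r : ∀ a, Var Δ a → Var Θ a) (b : Ty) :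
    (fun a x => (liftSubst s b a x).rename (liftRen r b)) =
      liftSubst (fun a x => (s a x).rename r) b := by
  funext a x
  cases x
  · rfl
  · simp only [liftSubst, Term.rename_rename]
    rfl

theorem Term.rename_subst {Γ : List Ty} {a : Ty} (M : Term S0 S2 Γ a) :
    ∀ {Δ Θ : List Ty} (s : ∀ a, Var Γ a → Term S0 S2 Δ a) (r : ∀ a, Var Δ a → Var Θ a),
      (M.subst s).rename r = M.subst (fun a x => (s a x).rename r) := by
  induction M with
  | app M N ihM ihN => intro Δ Θ s r; simp only [Term.rename, Term.subst, ihM, ihN]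
  | lam M ih => intro Δ Θ s r; simp only [Term.rename, Term.subst, ih, rename_liftSubst]
  | _ => intros; rfl

theorem subst_liftSubst {Γ Δ Θ : List Ty} (s : ∀ a, Var Γ a → Term S0 S2 Δ a)
    (s' : ∀ a, Var Δ a → Term S0 S2 Θ a) (b : Ty) :
    (fun a x => (liftSubst s b a x).subst (liftSubst s' b)) =
      liftSubst (fun a x => (s a x).subst s') b := by
  funext a x
  cases x
  · rfl
  · simp only [liftSubst, Term.subst_rename, Term.rename_subst]

theorem Term.subst_subst {Γ : List Ty} {a : Ty} (M : Term S0 S2 Γ a) :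
    ∀ {Δ Θ : List Ty} (s : ∀ a, Var Γ a → Term S0 S2 Δ a) (s' : ∀ a, Var Δ a → Term S0 S2 Θ a),
      (M.subst s).subst s' = M.subst (fun a x => (s a x).subst s') := by
  induction M with
  | app M N ihM ihN => intro Δ Θ s s'; simp only [Term.subst, ihM, ihN]
  | lam M ih => intro Δ Θ s s'; simp only [Term.subst, ih, subst_liftSubst]
  | _ => intros; rfl

theorem liftSubst_var (Γ : List Ty) (b : Ty) :
    liftSubst (fun a (x : Var Γ a) => (Term.var x : Term S0 S2 Γ a)) b = fun _ x => .var x := by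
  funext a x
  cases x <;> rfl

theorem Term.subst_var {Γ : List Ty} {a : Ty} (M : Term S0 S2 Γ a) :
    M.subst (fun _ x => .var x) = M := by
  induction M with
  | app M N ihM ihN => simp only [Term.subst, ihM, ihN]
  | lam M ih => simp only [Term.subst, liftSubst_var, ih]
  | _ => rfl

/-- Extension of a family indexed by the variables of a context by a value for the most recently
bound variable. It serves both for valuations and for substitutions. -/
def extend {X : Ty → Type w} {Γ : List Ty} {b : Ty} (p : X b) (e : ∀ a, Var Γ a → X a) :
    ∀ a, Var (b :: Γ) a → X a
  | _, .zero => p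
  | _, .succ x => e _ x

theorem Term.subst_liftSubst_instSubst {Γ Δ : List Ty} {a b : Ty} (M : Term S0 S2 (b :: Γ) a)
    (s : ∀ a, Var Γ a → Term S0 S2 Δ a) (N : Term S0 S2 Δ b) :
    (M.subst (liftSubst s b)).subst (instSubst N) =
      M.subst (extend (X := Term S0 S2 Δ) N s) := by
  rw [Term.subst_subst]
  congr 1
  funext c x
  cases x
  · rfl
  · simp only [liftSubst, Term.subst_rename]
    exact Term.subst_var _

end Substitution

/-! ### Invariance of values under reduction -/

/-- An extensional model of the calculus on the sets `X a`, given by its application, the values of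
terms, and the equations that these satisfy. Monotonicity plays no role here. -/
structure TermModel (S0 : Type u) (S2 : Type v) (X : Ty → Type w) where
  app {a b : Ty} : X (.arr a b) → X a → X b
  val {Γ : List Ty} {a : Ty} : Term S0 S2 Γ a → (∀ a, Var Γ a → X a) → X a
  ext {a b : Ty} (f g : X (.arr a b)) : (∀ p, app f p = app g p) → f = g
  val_var {Γ : List Ty} {a : Ty} (x : Var Γ a) (e : ∀ a, Var Γ a → X a) : val (.var x) e = e a x
  val_app {Γ : List Ty} {a b : Ty} (M : Term S0 S2 Γ (.arr a b)) (N : Term S0 S2 Γ a)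
    (e : ∀ a, Var Γ a → X a) : val (.app M N) e = app (val M e) (val N e)
  app_val_lam {Γ : List Ty} {a b : Ty} (M : Term S0 S2 (a :: Γ) b) (e : ∀ a, Var Γ a → X a)
    (p : X a) : app (val (.lam M) e) p = val M (extend p e)
  val_leaf {Γ Δ : List Ty} (c : S0) (e : ∀ a, Var Γ a → X a) (e' : ∀ a, Var Δ a → X a) :
    val (.leaf c) e = val (.leaf c) e'
  val_node {Γ Δ : List Ty} (c : S2) (e : ∀ a, Var Γ a → X a) (e' : ∀ a, Var Δ a → X a) :
    val (.node c) e = val (.node c) e'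
  val_undef {Γ Δ : List Ty} (a : Ty) (e : ∀ a, Var Γ a → X a) (e' : ∀ a, Var Δ a → X a) :
    val (.undef a) e = val (.undef a) e'
  val_div {Γ Δ : List Ty} (a : Ty) (e : ∀ a, Var Γ a → X a) (e' : ∀ a, Var Δ a → X a) :
    val (.div a) e = val (.div a) e'
  val_fix {Γ Δ : List Ty} (a : Ty) (e : ∀ a, Var Γ a → X a) (e' : ∀ a, Var Δ a → X a) :
    val (.fix a) e = val (.fix a) e'
  app_val_fix {Γ : List Ty} {a : Ty} (e : ∀ a, Var Γ a → X a) (f : X (.arr a a)) :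
    app (val (.fix a) e) f = app f (app (val (.fix a) e) f)

namespace TermModel

variable {S0 : Type u} {S2 : Type v} {X : Ty → Type w} (m : TermModel S0 S2 X)

theorem val_rename {Γ : List Ty} {a : Ty} (M : Term S0 S2 Γ a) :
    ∀ {Δ : List Ty} (r : ∀ a, Var Γ a → Var Δ a) (e : ∀ a, Var Δ a → X a),
      m.val (M.rename r) e = m.val M (fun a x => e a (r a x)) := by
  induction M with
  | var x => intro Δ r e; simp only [Term.rename, m.val_var]
  | app M N ihM ihN => intro Δ r e; simp only [Term.rename, m.val_app, ihM, ihN]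
  | lam M ih =>
    intro Δ r e
    refine m.ext _ _ fun p => ?_
    simp only [Term.rename, m.app_val_lam, ih]
    congr 1
    funext c x
    cases x <;> rfl
  | leaf c => intros; exact m.val_leaf _ _ _
  | node c => intros; exact m.val_node _ _ _
  | undef a => intros; exact m.val_undef _ _ _
  | div a => intros; exact m.val_div _ _ _
  | fix a => intros; exact m.val_fix _ _ _

theorem val_subst {Γ : List Ty} {a : Ty} (M : Term S0 S2 Γ a) :
    ∀ {Δ : List Ty} (s : ∀ a, Var Γ a → Term S0 S2 Δ a) (e : ∀ a, Var Δ a → X a),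
      m.val (M.subst s) e = m.val M (fun a x => m.val (s a x) e) := by
  induction M with
  | var x => intro Δ s e; simp only [Term.subst, m.val_var]
  | app M N ihM ihN => intro Δ s e; simp only [Term.subst, m.val_app, ihM, ihN]
  | lam M ih =>
    intro Δ s e
    refine m.ext _ _ fun p => ?_
    simp only [Term.subst, m.app_val_lam, ih]
    congr 1
    funext c x
    cases x
    · exact m.val_var _ _
    · exact m.val_rename _ _ _
  | leaf c => intros; exact m.val_leaf _ _ _
  | node c => intros; exact m.val_node _ _ _
  | undef a => intros; exact m.val_undef _ _ _
  | div a => intros; exact m.val_div _ _ _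
  | fix a => intros; exact m.val_fix _ _ _

theorem val_step {Γ : List Ty} {a : Ty} {M N : Term S0 S2 Γ a} (h : Step M N) :
    ∀ e : ∀ a, Var Γ a → X a, m.val M e = m.val N e := by
  induction h with
  | beta M N =>
    intro e
    rw [m.val_app, m.app_val_lam, m.val_subst]
    congr 1
    funext c x
    cases x
    · rfl
    · simp only [instSubst, m.val_var]
      rfl
  | delta M =>
    intro e
    rw [m.val_app, m.val_app, m.val_app]
    exact m.app_val_fix _ _
  | appLeft N _ ih => intro e; rw [m.val_app, m.val_app, ih]
  | appRight M _ ih => intro e; rw [m.val_app, m.val_app, ih]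
  | lam _ ih => intro e; exact m.ext _ _ fun p => by rw [m.app_val_lam, m.app_val_lam, ih]

theorem val_reduces {Γ : List Ty} {a : Ty} {M N : Term S0 S2 Γ a} (h : Reduces M N)
    (e : ∀ a, Var Γ a → X a) : m.val M e = m.val N e := by
  induction h with
  | refl => rfl
  | tail _ h ih => rw [ih, m.val_step h]

end TermModel

/-! ### The tree model -/

section TreeModel

variable (S0 : Type u) (S2 : Type v)

/-- The base set of the tree model: sets of labelled addresses. A tree is represented by its nodes
with a label in `S0 ∪ S2`; leaves labelled `Ω` are left out, so that `Ω` is the empty set. Not every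
such set represents a tree, which makes these sets a complete lattice. -/
abbrev TreeSet : Type (max u v) := Set (List Dir × (S0 ⊕ S2))

/-- The lattices of the tree model: `TreeSet` at the base type, and monotone functions above. -/
noncomputable def treeDom : Ty → CompleteLat.{max u v}
  | .o => .of (TreeSet S0 S2)
  | .arr a b => .of (treeDom a →o treeDom b)

variable {S0 S2}

/-- The tree that is a leaf with label `c`. -/
def treeLeaf (c : S0) : TreeSet S0 S2 := {([], .inl c)}

/-- The tree with root label `c` and subtrees `t₁` and `t₂`. -/
def treeNode (c : S2) (t₁ t₂ : TreeSet S0 S2) : TreeSet S0 S2 :=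
  {p | match p with
    | ([], l) => l = .inr c
    | (.one :: x, l) => (x, l) ∈ t₁
    | (.two :: x, l) => (x, l) ∈ t₂}

theorem treeLeaf_nonempty (c : S0) : (treeLeaf c : TreeSet S0 S2).Nonempty := ⟨_, rfl⟩

theorem treeNode_nonempty (c : S2) (t₁ t₂ : TreeSet S0 S2) : (treeNode c t₁ t₂).Nonempty :=
  ⟨([], .inr c), rfl⟩

theorem treeLeaf_injective {c d : S0} (h : (treeLeaf c : TreeSet S0 S2) = treeLeaf d) : c = d := by
  have : (([], .inl c) : List Dir × (S0 ⊕ S2)) ∈ treeLeaf d := h ▸ rfl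
  simpa [treeLeaf] using this

theorem treeLeaf_ne_treeNode (c : S0) (d : S2) (t₁ t₂ : TreeSet S0 S2) :
    treeLeaf c ≠ treeNode d t₁ t₂ := by
  intro h
  have : (([], .inr d) : List Dir × (S0 ⊕ S2)) ∈ treeLeaf c := h ▸ rfl
  simp [treeLeaf] at this

theorem treeNode_injective {c d : S2} {t₁ t₂ r₁ r₂ : TreeSet S0 S2}
    (h : treeNode c t₁ t₂ = treeNode d r₁ r₂) : c = d ∧ t₁ = r₁ ∧ t₂ = r₂ := by
  refine ⟨?_, ?_, ?_⟩
  · have : (([], .inr c) : List Dir × (S0 ⊕ S2)) ∈ treeNode d r₁ r₂ := h ▸ rfl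
    exact Sum.inr_injective this
  · ext ⟨x, l⟩
    exact Set.ext_iff.1 h (.one :: x, l)
  · ext ⟨x, l⟩
    exact Set.ext_iff.1 h (.two :: x, l)

theorem treeNode_mono (c : S2) {t₁ t₂ r₁ r₂ : TreeSet S0 S2} (h₁ : t₁ ≤ r₁) (h₂ : t₂ ≤ r₂) :
    treeNode c t₁ t₂ ≤ treeNode c r₁ r₂ := by
  rintro ⟨_ | ⟨_ | _, x⟩, l⟩ h
  exacts [h, h₁ h, h₂ h]

/-- An element of a function type of the tree model as a monotone function. -/
def treeHom {a b : Ty} (f : treeDom S0 S2 (.arr a b)) : treeDom S0 S2 a →o treeDom S0 S2 b := f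

/-- A monotone function as an element of a function type of the tree model. -/
def treeMk {a b : Ty} (f : treeDom S0 S2 a →o treeDom S0 S2 b) : treeDom S0 S2 (.arr a b) := f

/-- An element of the base type of the tree model as a set of labelled addresses. -/
def treeSet (t : treeDom S0 S2 .o) : TreeSet S0 S2 := t

/-- The constructor `treeNode` as an element of the tree model. -/
def treeNodeHom (c : S2) : treeDom S0 S2 (.arr .o (.arr .o .o)) :=
  treeMk ⟨fun t₁ => treeMk ⟨fun t₂ => treeNode c t₁ t₂, fun _ _ h => treeNode_mono c le_rfl h⟩,
    fun _ _ h _ => treeNode_mono c h le_rfl⟩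

/-- The least fixpoint operator as an element of the tree model. -/
noncomputable def treeFix (a : Ty) : treeDom S0 S2 (.arr (.arr a a) a) :=
  treeMk (OrderHom.lfp (α := treeDom S0 S2 a))

/-- The values of terms in the tree model, as monotone functions of the valuation. The value of `ω`
is arbitrary. -/
noncomputable def treeInterp : {Γ : List Ty} → {a : Ty} → Term S0 S2 Γ a →
    ((∀ a, Var Γ a → treeDom S0 S2 a) →o treeDom S0 S2 a)
  | _, _, .var x => ⟨fun e => e _ x, fun _ _ h => h _ x⟩
  | _, _, .app M N => ⟨fun e => treeHom (treeInterp M e) (treeInterp N e), fun e e' h =>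
      ((treeHom (treeInterp M e)).monotone ((treeInterp N).monotone h)).trans
        ((treeInterp M).monotone h _)⟩
  | _, _, .lam M =>
    ⟨fun e => treeMk ⟨fun p => treeInterp M (extend (X := fun a => treeDom S0 S2 a) p e),
        fun p p' h => (treeInterp M).monotone (by rintro c (_ | x); exacts [h, le_rfl])⟩,
      fun e e' h p => (treeInterp M).monotone (by rintro c (_ | x); exacts [le_rfl, h _ _])⟩
  | _, _, .leaf c => ⟨fun _ => treeLeaf c, fun _ _ _ => le_rfl⟩
  | _, _, .node c => ⟨fun _ => treeNodeHom c, fun _ _ _ => le_rfl⟩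
  | _, _, .undef _ => ⟨fun _ => ⊥, fun _ _ _ => le_rfl⟩
  | _, _, .div _ => ⟨fun _ => ⊥, fun _ _ _ => le_rfl⟩
  | _, _, .fix a => ⟨fun _ => treeFix a, fun _ _ _ => le_rfl⟩

variable (S0 S2) in
/-- The tree model satisfies the equations of an extensional model. -/
noncomputable def treeModel : TermModel S0 S2 (fun a => treeDom S0 S2 a) where
  app f := treeHom f
  val M := treeInterp M
  ext f g h := OrderHom.ext (treeHom f) (treeHom g) (funext h)
  val_var _ _ := rfl
  val_app _ _ _ := rfl
  app_val_lam _ _ _ := rfl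
  val_leaf _ _ _ := rfl
  val_node _ _ _ := rfl
  val_undef _ _ _ := rfl
  val_div _ _ _ := rfl
  val_fix _ _ _ := rfl
  app_val_fix _ f := (OrderHom.map_lfp (treeHom f)).symm

/-- The value of a closed term of type `0` in the tree model. -/
noncomputable def treeVal (M : Term S0 S2 [] .o) : TreeSet S0 S2 :=
  treeSet (treeInterp M (fun _ x => nomatch x))

theorem treeVal_reduces {M N : Term S0 S2 [] .o} (h : Reduces M N) : treeVal M = treeVal N :=
  (treeModel S0 S2).val_reduces h _

end TreeModel

/-! ### Adequacy of the tree model -/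

section Adequacy

variable {S0 : Type u} {S2 : Type v}

/-- The logical relation between the tree model and closed terms which at the base type says that
a term with a nonempty value has a head normal form. -/
def Realizes : {a : Ty} → treeDom S0 S2 a → Term S0 S2 [] a → Prop
  | .o, t, M => (treeSet t).Nonempty → ∃ H : Hnf S0 S2, Reduces M H.toTerm
  | .arr _ _, f, M => ∀ t N, Realizes t N → Realizes (treeHom f t) (.app M N)

theorem Realizes.of_step : ∀ {a : Ty} {t : treeDom S0 S2 a} {M M' : Term S0 S2 [] a},
    Step M M' → Realizes t M' → Realizes t M
  | .o, _, _, _, h, h' => fun hne =>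
    let ⟨H, hH⟩ := h' hne
    ⟨H, .head h hH⟩
  | .arr _ _, _, _, _, h, h' => fun t N hN => of_step (.appLeft N h) (h' t N hN)

theorem sSup_treeHom_apply {a b : Ty} (s : Set (treeDom S0 S2 (.arr a b))) (t : treeDom S0 S2 a) :
    treeHom (sSup s) t = sSup ((fun f => treeHom f t) '' s) := by
  rw [sSup_image]
  exact OrderHom.sSup_apply (α := treeDom S0 S2 a) (β := treeDom S0 S2 b) s t

theorem realizes_sSup : ∀ {a : Ty} {s : Set (treeDom S0 S2 a)} {M : Term S0 S2 [] a},
    (∀ t ∈ s, Realizes t M) → Realizes (sSup s) M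
  | .o, s, _, h => fun hne => by
    obtain ⟨x, t, ht, hx⟩ := hne
    exact h t ht ⟨x, hx⟩
  | .arr _ _, s, _, h => fun t N hN => by
    rw [sSup_treeHom_apply]
    refine realizes_sSup ?_
    rintro _ ⟨f, hf, rfl⟩
    exact h f hf t N hN

theorem Realizes.bot {a : Ty} (M : Term S0 S2 [] a) : Realizes ⊥ M := by
  rw [← sSup_empty]
  exact realizes_sSup fun t ht => ht.elim

theorem realizes_fix (a : Ty) : Realizes (treeFix a) (.fix a : Term S0 S2 [] _) := by
  intro f M hM
  refine OrderHom.lfp_induction (treeHom f) (p := fun t => Realizes t (.app (.fix a) M))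
    (fun t ht _ => .of_step (.delta M) (hM t _ ht)) fun s hs => realizes_sSup hs

/-- The fundamental lemma of the logical relation `Realizes`. -/
theorem realizes_subst {Γ : List Ty} {a : Ty} (M : Term S0 S2 Γ a) :
    ∀ (e : ∀ a, Var Γ a → treeDom S0 S2 a) (s : ∀ a, Var Γ a → Term S0 S2 [] a),
      (∀ a x, Realizes (e a x) (s a x)) → Realizes (treeInterp M e) (M.subst s) := by
  induction M with
  | var x => exact fun e s h => h _ x
  | app M N ihM ihN => exact fun e s h => ihM e s h _ _ (ihN e s h)
  | lam M ih =>
    intro e s h t N hN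
    refine .of_step (.beta _ _) ?_
    rw [Term.subst_liftSubst_instSubst]
    exact ih _ _ (by rintro c (_ | x); exacts [hN, h _ _])
  | leaf c => exact fun _ _ _ _ => ⟨.leaf c, .refl⟩
  | node c => exact fun _ _ _ _ N₁ _ _ N₂ _ _ => ⟨.node c N₁ N₂, .refl⟩
  | undef a => exact fun _ _ _ => .bot _
  | div a => exact fun _ _ _ => .bot _
  | fix a => exact fun _ _ _ => realizes_fix a

theorem exists_hnf_of_treeVal_nonempty {M : Term S0 S2 [] .o} (h : (treeVal M).Nonempty) :
    ∃ H : Hnf S0 S2, Reduces M H.toTerm := by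
  have key := realizes_subst M (fun _ x => nomatch x) (fun _ x => .var x) (fun _ x => nomatch x)
  rw [Term.subst_var] at key
  exact key h

theorem reduces_of_hnf_eq_some {M : Term S0 S2 [] .o} {H : Hnf S0 S2} (h : hnf M = some H) :
    Reduces M H.toTerm := by
  unfold hnf at h
  split at h
  · next hex =>
    cases h
    exact hex.choose_spec
  · cases h

theorem treeVal_of_hnf_eq_none {M : Term S0 S2 [] .o} (h : hnf M = none) : treeVal M = ∅ := by
  by_contra hne
  have hex := exists_hnf_of_treeVal_nonempty (Set.nonempty_iff_ne_empty.2 hne)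
  simp [hnf, hex] at h

end Adequacy

/-! ### Acceptance of elements of the tree model -/

section Acceptance

variable {S0 : Type u} {S2 : Type v} {Q : Type w}

/-- The local condition on the root of `t` for acceptance from the state `q`, where `X` gives the
states from which the subtrees are to be accepted. -/
def TAC.Local (A : TAC S0 S2 Q) (X : TreeSet S0 S2 → Q → Prop) (t : TreeSet S0 S2) (q : Q) : Prop :=
  (t = ∅ ∧ A.leafOk q none = true) ∨ (∃ c, t = treeLeaf c ∧ A.leafOk q (some c) = true) ∨
    ∃ c t₁ t₂ q₁ q₂, t = treeNode c t₁ t₂ ∧ (q₁, q₂) ∈ A.trans q c ∧ X t₁ q₁ ∧ X t₂ q₂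

/-- Acceptance of the tree `t` from the state `q`, as the greatest relation that satisfies the local
conditions. -/
def TAC.Accepts (A : TAC S0 S2 Q) (t : TreeSet S0 S2) (q : Q) : Prop :=
  ∃ X : TreeSet S0 S2 → Q → Prop, X t q ∧ ∀ t q, X t q → A.Local X t q

theorem TAC.Accepts.local {A : TAC S0 S2 Q} {t : TreeSet S0 S2} {q : Q} (h : A.Accepts t q) :
    A.Local A.Accepts t q := by
  obtain ⟨X, hX, hl⟩ := h
  rcases hl t q hX with h | h | ⟨c, t₁, t₂, q₁, q₂, h, hq, h₁, h₂⟩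
  · exact .inl h
  · exact .inr (.inl h)
  · exact .inr (.inr ⟨c, t₁, t₂, q₁, q₂, h, hq, ⟨X, h₁, hl⟩, ⟨X, h₂, hl⟩⟩)

theorem TAC.Accepts.leafOk_none {A : TAC S0 S2 Q} {q : Q} (h : A.Accepts ∅ q) :
    A.leafOk q none = true := by
  rcases h.local with h | ⟨c, h, -⟩ | ⟨c, t₁, t₂, q₁, q₂, h, -⟩
  · exact h.2
  · exact absurd h.symm (treeLeaf_nonempty c).ne_empty
  · exact absurd h.symm (treeNode_nonempty c t₁ t₂).ne_empty

theorem TAC.Accepts.leafOk_some {A : TAC S0 S2 Q} {q : Q} {c : S0}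
    (h : A.Accepts (treeLeaf c) q) : A.leafOk q (some c) = true := by
  rcases h.local with h | ⟨d, h, hd⟩ | ⟨d, t₁, t₂, q₁, q₂, h, -⟩
  · exact absurd h.1 (treeLeaf_nonempty c).ne_empty
  · rwa [treeLeaf_injective h]
  · exact absurd h (treeLeaf_ne_treeNode _ _ _ _)

theorem TAC.Accepts.exists_trans {A : TAC S0 S2 Q} {q : Q} {c : S2} {t₁ t₂ : TreeSet S0 S2}
    (h : A.Accepts (treeNode c t₁ t₂) q) :
    ∃ q₁ q₂, (q₁, q₂) ∈ A.trans q c ∧ A.Accepts t₁ q₁ ∧ A.Accepts t₂ q₂ := by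
  rcases h.local with h | ⟨d, h, -⟩ | ⟨d, r₁, r₂, q₁, q₂, h, hq, h₁, h₂⟩
  · exact absurd h.1 (treeNode_nonempty c t₁ t₂).ne_empty
  · exact absurd h.symm (treeLeaf_ne_treeNode _ _ _ _)
  · obtain ⟨rfl, rfl, rfl⟩ := treeNode_injective h
    exact ⟨q₁, q₂, hq, h₁, h₂⟩

end Acceptance

/-! ### Comparison of the tree model with the model K -/

section Comparison

variable {S0 : Type u} {S2 : Type v} {Q : Type w}

/-- The element of `D₀` that is the first component of an element of `K₀`. -/
noncomputable def first (W : Set Q) (p : K W .o) : Bool :=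
  (show {x : Bool × Set Q // x.1 = ⊤ ∨ x = (⊥, W)} from p).1.1

theorem second_of_first (W : Set Q) (p : K W .o) (h : ¬ first W p = ⊤) : second W p = W := by
  rcases (show {x : Bool × Set Q // x.1 = ⊤ ∨ x = (⊥, W)} from p).2 with h' | h'
  · exact absurd h' h
  · exact congrArg Prod.snd h'

/-- The logical relation between the tree model and the model `D` which at the base type says that
`⊤` stands for the nonempty trees. -/
def Detects (W : Set Q) : {a : Ty} → treeDom S0 S2 a → D W a → Prop
  | .o, t, d => (show Bool from d) = ⊤ ↔ (treeSet t).Nonempty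
  | .arr _ _, f, d => ∀ t e, Detects W t e → Detects W (treeHom f t) (dhom W d e)

/-- The logical relation between the tree model and the model `K` which at the base type says that
the first component stands for the nonempty trees, and that the second contains all states from
which the tree is accepted. -/
def Covers (A : TAC S0 S2 Q) : {a : Ty} → treeDom S0 S2 a → K A.divStates a → Prop
  | .o, t, p => (first _ p = ⊤ ↔ (treeSet t).Nonempty) ∧
      ∀ q, A.Accepts (treeSet t) q → q ∈ second _ p
  | .arr _ _, f, g => ∀ t p, Covers A t p → Covers A (treeHom f t) (ap _ g p)

theorem sSup_dhom_apply (W : Set Q) {a b : Ty} (s : Set (D W (.arr a b))) (d : D W a) :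
    dhom W (sSup s) d = sSup ((fun f => dhom W f d) '' s) := by
  rw [sSup_image]
  exact OrderHom.sSup_apply (α := D W a) (β := D W b) s d

theorem detects_sSup (W : Set Q) : ∀ {a : Ty} {s : Set (treeDom S0 S2 a × D W a)},
    (∀ x ∈ s, Detects W x.1 x.2) → Detects W (sSup (Prod.fst '' s)) (sSup (Prod.snd '' s))
  | .o, s, h => by
    constructor
    · intro htop
      by_contra hne
      have hle : sSup (Prod.snd '' s) ≤ (⊥ : D W .o) := by
        refine sSup_le ?_
        rintro _ ⟨x, hx, rfl⟩
        by_contra hx'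
        have hx1 : (show Bool from x.2) = ⊤ := by
          rcases Bool.eq_false_or_eq_true (show Bool from x.2) with h1 | h1
          · exact h1
          · exact absurd (le_of_eq h1 : (show Bool from x.2) ≤ ⊥) hx'
        obtain ⟨y, hy⟩ := (h x hx).1 hx1
        exact hne ⟨y, x.1, ⟨x, hx, rfl⟩, hy⟩
      have : (⊤ : Bool) ≤ ⊥ := htop.symm.le.trans hle
      exact absurd this (by decide)
    · rintro ⟨y, _, ⟨x, hx, rfl⟩, hy⟩
      have h1 : (show Bool from x.2) = ⊤ := (h x hx).2 ⟨y, hy⟩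
      have h2 : x.2 ≤ sSup (Prod.snd '' s) := le_sSup ⟨x, hx, rfl⟩
      exact top_le_iff.1 (h1.symm.le.trans h2)
  | .arr a b, s, h => by
    intro t e hte
    rw [sSup_treeHom_apply, sSup_dhom_apply, Set.image_image, Set.image_image]
    have := detects_sSup W (s := (fun x => (treeHom x.1 t, dhom W x.2 e)) '' s) (by
      rintro _ ⟨x, hx, rfl⟩
      exact h x hx t e hte)
    rwa [Set.image_image, Set.image_image] at this

theorem lfp_prodMap {α : Type u} {β : Type v} [CompleteLattice α] [CompleteLattice β]
    (f : α →o α) (g : β →o β) : OrderHom.lfp (f.prodMap g) = (OrderHom.lfp f, OrderHom.lfp g) := by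
  refine le_antisymm (OrderHom.lfp_le _ ⟨(OrderHom.map_lfp f).le, (OrderHom.map_lfp g).le⟩) ?_
  have h := OrderHom.map_lfp (f.prodMap g)
  exact ⟨OrderHom.lfp_le _ (congrArg Prod.fst h).le, OrderHom.lfp_le _ (congrArg Prod.snd h).le⟩

/-- The two least fixpoints are reached by a joint induction, on the product of the lattices. No
continuity is needed, because `Detects` is closed under arbitrary componentwise suprema. -/
theorem Detects.lfp (W : Set Q) {a : Ty} {f : treeDom S0 S2 (.arr a a)} {d : D W (.arr a a)}
    (h : Detects W f d) : Detects W (treeHom (treeFix a) f) (dfix W d) := by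
  have key : Detects W (OrderHom.lfp ((treeHom f).prodMap (dhom W d))).1
      (OrderHom.lfp ((treeHom f).prodMap (dhom W d))).2 :=
    OrderHom.lfp_induction _ (p := fun x : treeDom S0 S2 a × D W a => Detects W x.1 x.2)
      (fun x hx _ => h _ _ hx) fun s hs => detects_sSup W hs
  rwa [lfp_prodMap] at key

/-- The embedding `d ↦ d↑` satisfies `d↑(p) = d(p̄)↑`: the right-hand side defines an element of `K`
related to `d`, and `d↑` is the greatest such element. -/
theorem ap_up (W : Set Q) {a b : Ty} (d : D W (.arr a b)) (p : K W a) :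
    ap W (up W d) p = up W (dhom W d (bar W p)) := by
  refine le_antisymm (le_up W (ap_rel W (up_rel W d) (bar_spec W p)) le_rfl) ?_
  have hL : ∀ g e, L W g e → L W (up W (dhom W d (bar W g))) (dhom W d e) := by
    intro g e h
    rw [bar_eq W h]
    exact up_rel W _
  have hm : Monotone fun x => up W (dhom W d (bar W x)) := fun x y h =>
    le_up W (up_rel W _) ((dhom W d).monotone (bar_mono W h))
  have hle : mkK W _ hm ⟨dhom W d, hL⟩ ≤ up W d :=
    le_up W (d := d) (show L W (mkK W _ hm ⟨dhom W d, hL⟩) d from hL) le_rfl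
  exact ap_le W hle p

/-- The two logical relations correspond along `p ↦ p̄` and `d ↦ d↑`. -/
theorem covers_detects (A : TAC S0 S2 Q) : ∀ a : Ty,
    (∀ (t : treeDom S0 S2 a) (p : K A.divStates a), Covers A t p → Detects _ t (bar _ p)) ∧
    ∀ (t : treeDom S0 S2 a) (d : D A.divStates a), Detects _ t d → Covers A t (up _ d)
  | .o => by
    have hfst : ∀ (p : K A.divStates .o) (d : D A.divStates .o), L _ p d → first _ p = d :=
      fun _ _ h => h
    refine ⟨fun t p h => ?_, fun t d h => ⟨?_, fun q hq => ?_⟩⟩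
    · have := hfst p _ (bar_spec _ p)
      exact this ▸ h.1
    · rw [hfst _ _ (up_rel _ d)]
      exact h
    -- If `d = ⊤`, then `d↑` is `(⊤, Q)`; otherwise it is `(⊥, Q_Ω)`, and the tree is `Ω`.
    · by_cases hd : first _ (up _ d) = ⊤
      · have hle : topPair A.divStates Set.univ ≤ up _ d :=
          (up_spec _ d).2 (hd.symm.trans (hfst _ _ (up_rel _ d)))
        exact hle.2 (Set.mem_univ q)
      · rw [second_of_first _ _ hd]
        have : treeSet t = ∅ := by
          rw [hfst _ _ (up_rel _ d)] at hd
          by_contra hne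
          exact hd (h.2 (Set.nonempty_iff_ne_empty.2 hne))
        rw [this] at hq
        exact hq.leafOk_none
  | .arr a b => by
    obtain ⟨ha, ha'⟩ := covers_detects A a
    obtain ⟨hb, hb'⟩ := covers_detects A b
    refine ⟨fun f g h t d htd => ?_, fun f d h t p htp => ?_⟩
    · have := hb _ _ (h _ _ (ha' t d htd))
      rwa [bar_eq _ (ap_rel _ (bar_spec _ g) (up_rel _ d))] at this
    · rw [ap_up]
      exact hb' _ _ (h _ _ (ha t p htp))

theorem covers_div (A : TAC S0 S2 Q) : ∀ a : Ty,
    Covers A (⊥ : treeDom S0 S2 a) (bbot A.divStates a)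
  | .o => ⟨⟨fun h => absurd (show (⊥ : Bool) = ⊤ from h) (by decide),
      fun h => absurd rfl h.ne_empty⟩,
      fun _ h => TAC.Accepts.leafOk_none h⟩
  | .arr _ b => fun _ _ _ => covers_div A b

variable [Finite Q]

/-- All members of the sequence whose meet defines `Fix` cover the least fixpoint of the tree model:
the first one because the least fixpoints are related by `Detects`, the others because the least
fixpoint is invariant under a further application. -/
theorem covers_fix (A : TAC S0 S2 Q) (a : Ty) :
    Covers A (treeFix a : treeDom S0 S2 _) (fixK A.divStates a) := by
  intro f g h
  have hiter : ∀ n, Covers A (treeHom (treeFix a) f) (iter _ g n) := by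
    intro n
    induction n with
    | zero =>
      exact (covers_detects A a).2 _ _ (Detects.lfp _ ((covers_detects A (.arr a a)).1 f g h))
    | succ n ih =>
      rw [iter_succ, show treeHom (treeFix a) f = treeHom f (treeHom (treeFix a) f) from
        (OrderHom.map_lfp (treeHom f)).symm]
      exact h _ _ ih
  exact hiter _

/-- The fundamental lemma of the logical relation `Covers`. It fails for `ω`, which is `⊤` in `K` and
`⊥` in the tree model. -/
theorem covers_interp (A : TAC S0 S2 Q) {Γ : List Ty} {a : Ty} (M : Term S0 S2 Γ a) :
    M.UndefFree → ∀ (e : ∀ a, Var Γ a → treeDom S0 S2 a) (v : Env A.divStates Γ),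
      (∀ a x, Covers A (e a x) (v a x)) →
      Covers A (treeInterp M e) ((interp A.divStates
        (fun c => topPair _ {q | A.leafOk q (some c) = true})
        (fun c => nodeK _ (fun q => A.trans q c)) M).toFun v) := by
  induction M with
  | var x => exact fun _ _ _ h => h _ x
  | app M N ihM ihN => exact fun hM e v h => ihM hM.1 e v h _ _ (ihN hM.2 e v h)
  | lam M ih =>
    intro hM e v h t p htp
    exact ih hM _ _ (by rintro c (_ | x); exacts [htp, h _ _])
  | leaf c =>
    exact fun _ _ _ _ => ⟨iff_of_true rfl (treeLeaf_nonempty c), fun _ h => h.leafOk_some⟩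
  | node c =>
    intro _ _ _ _ t₁ p₁ h₁ t₂ p₂ h₂
    refine ⟨iff_of_true rfl (treeNode_nonempty c t₁ t₂), fun q h => ?_⟩
    obtain ⟨q₁, q₂, hq, hq₁, hq₂⟩ := TAC.Accepts.exists_trans h
    exact ⟨(q₁, q₂), hq, h₁.2 _ hq₁, h₂.2 _ hq₂⟩
  | undef a => exact fun h => h.elim
  | div a => exact fun _ _ _ _ => covers_div A a
  | fix a => exact fun _ _ _ _ => covers_fix A a

theorem covers_value (A : TAC S0 S2 Q) {M : Term S0 S2 [] .o} (hM : M.UndefFree) :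
    (first _ (A.value M) = ⊤ ↔ (treeVal M).Nonempty) ∧
      ∀ q, A.Accepts (treeVal M) q → q ∈ second _ (A.value M) :=
  covers_interp A M hM _ _ (fun _ x => nomatch x)

end Comparison

/-! ### The equations for the state sets of values -/

section Value

variable {S0 : Type u} {S2 : Type v} {Q : Type w} [Finite Q]

theorem ap_fixpt (W : Set Q) {a : Ty} (f : K W (.arr a a)) : ap W f (fixpt W f) = fixpt W f := by
  have h : ap W f (fixpt W f) = iter W f ((exists_isGLB_iter W f).choose + 1) :=
    (iter_succ W f _).symm
  refine le_antisymm ?_ ?_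
  · rw [h]
    exact iter_antitone W f (Nat.le_succ _)
  · rw [h]
    exact (fixpt_isGLB W f).1 ⟨_, rfl⟩

/-- The model `K` satisfies the equations of an extensional model. -/
noncomputable def kModel (W : Set Q) (ρ₀ : S0 → K W .o) (ρ₂ : S2 → K W (.arr .o (.arr .o .o))) :
    TermModel S0 S2 (fun a => K W a) where
  app f := ap W f
  val M := (interp W ρ₀ ρ₂ M).toFun
  ext _ _ h := Subtype.ext (OrderHom.ext _ _ (funext h))
  val_var _ _ := rfl
  val_app _ _ _ := rfl
  app_val_lam M e p := congrArg (interp W ρ₀ ρ₂ M).toFun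
    (show Env.cons p e = extend (X := fun a => K W a) p e by funext c x; cases x <;> rfl)
  val_leaf _ _ _ := rfl
  val_node _ _ _ := rfl
  val_undef _ _ _ := rfl
  val_div _ _ _ := rfl
  val_fix _ _ _ := rfl
  app_val_fix _ f := (ap_fixpt W f).symm

/-- The states in the second component of the value of a closed term of type `0`. -/
noncomputable def TAC.states (A : TAC S0 S2 Q) (M : Term S0 S2 [] .o) : Set Q :=
  second A.divStates (A.value M)

theorem TAC.states_reduces (A : TAC S0 S2 Q) {M N : Term S0 S2 [] .o} (h : Reduces M N) :
    A.states M = A.states N :=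
  congrArg (second A.divStates) ((kModel A.divStates _ _).val_reduces h _)

theorem TAC.leafOk_some_of_mem_states {A : TAC S0 S2 Q} {M : Term S0 S2 [] .o} {c : S0} {q : Q}
    (h : hnf M = some (.leaf c)) (hq : q ∈ A.states M) : A.leafOk q (some c) = true := by
  rw [A.states_reduces (reduces_of_hnf_eq_some h)] at hq
  exact hq

theorem TAC.exists_trans_of_mem_states {A : TAC S0 S2 Q} {M N₁ N₂ : Term S0 S2 [] .o} {c : S2}
    {q : Q} (h : hnf M = some (.node c N₁ N₂)) (hq : q ∈ A.states M) :
    ∃ p ∈ A.trans q c, p.1 ∈ A.states N₁ ∧ p.2 ∈ A.states N₂ := by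
  rw [A.states_reduces (reduces_of_hnf_eq_some h)] at hq
  exact hq

theorem TAC.leafOk_none_of_mem_states {A : TAC S0 S2 Q} {M : Term S0 S2 [] .o} {q : Q}
    (hM : M.UndefFree) (h : hnf M = none) (hq : q ∈ A.states M) : A.leafOk q none = true := by
  have hne : ¬ first _ (A.value M) = ⊤ := fun ht =>
    ((covers_value A hM).1.1 ht).ne_empty (treeVal_of_hnf_eq_none h)
  rw [TAC.states, second_of_first _ _ hne] at hq
  exact hq

end Value

/-! ### Böhm trees and runs -/

section Runs

variable {S0 : Type u} {S2 : Type v} {Q : Type w}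

theorem Term.UndefFree.rename {Γ : List Ty} {a : Ty} {M : Term S0 S2 Γ a} :
    M.UndefFree → ∀ {Δ : List Ty} (r : ∀ a, Var Γ a → Var Δ a), (M.rename r).UndefFree := by
  induction M with
  | app M N ihM ihN => exact fun h _ r => ⟨ihM h.1 r, ihN h.2 r⟩
  | lam M ih => exact fun h _ r => ih (show M.UndefFree from h) _
  | undef a => exact fun h => h.elim
  | _ => exact fun _ _ _ => trivial

theorem Term.UndefFree.subst {Γ : List Ty} {a : Ty} {M : Term S0 S2 Γ a} :
    M.UndefFree → ∀ {Δ : List Ty} (s : ∀ a, Var Γ a → Term S0 S2 Δ a),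
      (∀ a x, (s a x).UndefFree) → (M.subst s).UndefFree := by
  induction M with
  | var x => exact fun _ _ s hs => hs _ x
  | app M N ihM ihN => exact fun h _ s hs => ⟨ihM h.1 s hs, ihN h.2 s hs⟩
  | lam M ih =>
    intro h _ s hs
    refine ih (show M.UndefFree from h) _ ?_
    rintro c (_ | x)
    exacts [trivial, (hs _ _).rename _]
  | undef a => exact fun h => h.elim
  | _ => exact fun _ _ _ _ => trivial

theorem Term.UndefFree.step {Γ : List Ty} {a : Ty} {M N : Term S0 S2 Γ a} (h : Step M N) :
    M.UndefFree → N.UndefFree := by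
  induction h with
  | beta M N =>
    intro h
    refine Term.UndefFree.subst (show M.UndefFree from h.1) _ ?_
    rintro c (_ | x)
    exacts [h.2, trivial]
  | delta M => exact fun h => ⟨h.2, h⟩
  | appLeft N _ ih => exact fun h => ⟨ih h.1, h.2⟩
  | appRight M _ ih => exact fun h => ⟨h.1, ih h.2⟩
  | lam _ ih => exact ih

theorem Term.UndefFree.reduces {Γ : List Ty} {a : Ty} {M N : Term S0 S2 Γ a} (hM : M.UndefFree)
    (h : Reduces M N) : N.UndefFree := by
  induction h with
  | refl => exact hM
  | tail _ h ih => exact ih.step h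

theorem undefFree_of_hnf_eq_node {M N₁ N₂ : Term S0 S2 [] .o} {c : S2} (hM : M.UndefFree)
    (h : hnf M = some (.node c N₁ N₂)) : N₁.UndefFree ∧ N₂.UndefFree :=
  have := hM.reduces (reduces_of_hnf_eq_some h)
  ⟨this.1.2, this.2⟩

/-- The component of a pair in a direction. -/
def Dir.pick {α : Type*} : Dir → α × α → α
  | .one, p => p.1
  | .two, p => p.2

theorem bohmTree_nil_eq_node {M : Term S0 S2 [] .o} {c : S2} :
    bohmTree M [] = some (.node c) ↔ ∃ N₁ N₂, hnf M = some (.node c N₁ N₂) := by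
  rw [bohmTree]
  rcases hnf M with _ | ⟨_ | _⟩ <;> simp

theorem bohmTree_cons {M N₁ N₂ : Term S0 S2 [] .o} {c : S2} (h : hnf M = some (.node c N₁ N₂))
    (i : Dir) (x : List Dir) : bohmTree M (i :: x) = bohmTree (i.pick (N₁, N₂)) x := by
  cases i <;> simp [bohmTree, h, Dir.pick]

theorem exists_hnf_of_bohmTree_cons {M : Term S0 S2 [] .o} {i : Dir} {x : List Dir}
    (h : (bohmTree M (i :: x)).isSome) : ∃ c N₁ N₂, hnf M = some (.node c N₁ N₂) := by
  cases i <;> rw [bohmTree] at h <;> rcases hM : hnf M with _ | ⟨_ | _⟩ <;> simp_all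

theorem bohmTree_nil_isSome (M : Term S0 S2 [] .o) : (bohmTree M []).isSome := by
  rw [bohmTree]
  rcases hnf M with _ | ⟨_ | _⟩ <;> rfl

/-- Every subtree of a Böhm tree is a Böhm tree. -/
theorem exists_bohmTree_append {x : List Dir} : ∀ {M : Term S0 S2 [] .o},
    (bohmTree M x).isSome → ∃ N : Term S0 S2 [] .o, ∀ y, bohmTree M (x ++ y) = bohmTree N y := by
  induction x with
  | nil => exact fun {M} _ => ⟨M, fun _ => rfl⟩
  | cons i x ih =>
    intro M h
    obtain ⟨c, N₁, N₂, hM⟩ := exists_hnf_of_bohmTree_cons h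
    rw [bohmTree_cons hM] at h
    obtain ⟨N, hN⟩ := ih h
    exact ⟨N, fun y => by rw [List.cons_append, bohmTree_cons hM, hN]⟩

theorem isTree_bohmTree (M : Term S0 S2 [] .o) : IsTree (bohmTree M) where
  root := bohmTree_nil_isSome M
  prefixClosed x := by
    induction x generalizing M with
    | nil => exact fun _ _ => bohmTree_nil_isSome M
    | cons i x ih =>
      intro y h
      obtain ⟨c, N₁, N₂, hM⟩ := exists_hnf_of_bohmTree_cons h
      rw [List.cons_append, bohmTree_cons hM] at h
      rw [bohmTree_cons hM]
      exact ih _ y h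
  children x c h i := by
    obtain ⟨N, hN⟩ := exists_bohmTree_append (Option.isSome_iff_exists.2 ⟨_, h⟩)
    rw [← x.append_nil, hN, bohmTree_nil_eq_node] at h
    obtain ⟨N₁, N₂, h⟩ := h
    rw [hN, bohmTree_cons h]
    exact bohmTree_nil_isSome _
  leaves x c h y hy := by
    obtain ⟨N, hN⟩ := exists_bohmTree_append (Option.isSome_iff_exists.2 ⟨_, h⟩)
    rw [hN] at hy
    cases y with
    | nil => rfl
    | cons i y =>
      obtain ⟨d, N₁, N₂, hd⟩ := exists_hnf_of_bohmTree_cons hy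
      rw [← x.append_nil, hN, bohmTree_nil_eq_node.2 ⟨N₁, N₂, hd⟩] at h
      cases h

/-- `r` is an accepting run on `t` that starts in the state `q` instead of the initial state. -/
def TAC.AcceptingRun (A : TAC S0 S2 Q) (t : PTree S0 S2) (q : Q) (r : List Dir → Option Q) : Prop :=
  { A with init := q }.IsRun t r ∧ A.Accepting t r

theorem TAC.AcceptingRun.cons {A : TAC S0 S2 Q} {M N₁ N₂ : Term S0 S2 [] .o} {c : S2} {q q' : Q}
    {r : List Dir → Option Q} (h : hnf M = some (.node c N₁ N₂)) (i : Dir)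
    (hr : A.AcceptingRun (bohmTree M) q r) (hi : r [i] = some q') :
    A.AcceptingRun (bohmTree (i.pick (N₁, N₂))) q' (fun x => r (i :: x)) := by
  refine ⟨⟨fun x => ?_, hi, fun x d p p₁ p₂ hx => ?_⟩, fun x d p hx => ?_⟩
  · rw [← bohmTree_cons h]
    exact hr.1.domain _
  · rw [← bohmTree_cons h] at hx
    exact hr.1.step (i :: x) d p p₁ p₂ hx
  · rw [← bohmTree_cons h] at hx
    exact hr.2 (i :: x) d p hx

/-- Acceptance of the Böhm tree of a term implies acceptance of its value in the tree model. -/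
theorem TAC.AcceptingRun.accepts {A : TAC S0 S2 Q} {M : Term S0 S2 [] .o} {q : Q}
    {r : List Dir → Option Q} (h : A.AcceptingRun (bohmTree M) q r) : A.Accepts (treeVal M) q := by
  refine ⟨fun t q => ∃ M r, t = treeVal M ∧ A.AcceptingRun (bohmTree M) q r, ⟨M, r, rfl, h⟩, ?_⟩
  rintro _ q ⟨M, r, rfl, hr⟩
  rcases hM : hnf M with _ | ⟨c | ⟨c, N₁, N₂⟩⟩
  · exact .inl ⟨treeVal_of_hnf_eq_none hM, hr.2 [] none q (by rw [bohmTree, hM]) hr.1.init⟩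
  · refine .inr (.inl ⟨c, treeVal_reduces (reduces_of_hnf_eq_some hM), ?_⟩)
    exact hr.2 [] (some c) q (by rw [bohmTree, hM]) hr.1.init
  · have hsome : ∀ i : Dir, ∃ q', r [i] = some q' := fun i =>
      Option.isSome_iff_exists.1 ((hr.1.domain [i]).2 (by
        rw [bohmTree_cons hM]
        exact bohmTree_nil_isSome _))
    obtain ⟨q₁, h₁⟩ := hsome .one
    obtain ⟨q₂, h₂⟩ := hsome .two
    refine .inr (.inr ⟨c, treeVal N₁, treeVal N₂, q₁, q₂,
      treeVal_reduces (reduces_of_hnf_eq_some hM), ?_, ?_, ?_⟩)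
    · exact hr.1.step [] c q q₁ q₂ (bohmTree_nil_eq_node.2 ⟨N₁, N₂, hM⟩) hr.1.init h₁ h₂
    · exact ⟨N₁, _, rfl, hr.cons hM .one h₁⟩
    · exact ⟨N₂, _, rfl, hr.cons hM .two h₂⟩

variable [Finite Q]

open Classical in
/-- Some transition from `q` on `c` into the state sets of the two subterms, if there is any;
otherwise the value is arbitrary. -/
noncomputable def TAC.choice (A : TAC S0 S2 Q) (q : Q) (c : S2) (N₁ N₂ : Term S0 S2 [] .o) :
    Q × Q :=
  if h : ∃ p ∈ A.trans q c, p.1 ∈ A.states N₁ ∧ p.2 ∈ A.states N₂ then h.choose else (q, q)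

theorem TAC.choice_spec {A : TAC S0 S2 Q} {M N₁ N₂ : Term S0 S2 [] .o} {c : S2} {q : Q}
    (h : hnf M = some (.node c N₁ N₂)) (hq : q ∈ A.states M) :
    A.choice q c N₁ N₂ ∈ A.trans q c ∧ (A.choice q c N₁ N₂).1 ∈ A.states N₁ ∧
      (A.choice q c N₁ N₂).2 ∈ A.states N₂ := by
  have hex := exists_trans_of_mem_states h hq
  rw [TAC.choice, dif_pos hex]
  exact hex.choose_spec

/-- The run on the Böhm tree of `M` from the state `q` that is built downwards by `TAC.choice`. -/
noncomputable def TAC.run (A : TAC S0 S2 Q) : Term S0 S2 [] .o → Q → List Dir → Option Q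
  | _, q, [] => some q
  | M, q, i :: x =>
    match hnf M with
    | some (.node c N₁ N₂) => A.run (i.pick (N₁, N₂)) (i.pick (A.choice q c N₁ N₂)) x
    | _ => none
termination_by _ _ x => x.length

theorem TAC.run_cons {A : TAC S0 S2 Q} {M N₁ N₂ : Term S0 S2 [] .o} {c : S2}
    (h : hnf M = some (.node c N₁ N₂)) (q : Q) (i : Dir) (x : List Dir) :
    A.run M q (i :: x) = A.run (i.pick (N₁, N₂)) (i.pick (A.choice q c N₁ N₂)) x := by
  rw [TAC.run, h]

theorem TAC.exists_hnf_of_run_cons {A : TAC S0 S2 Q} {M : Term S0 S2 [] .o} {q : Q} {i : Dir}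
    {x : List Dir} (h : (A.run M q (i :: x)).isSome) : ∃ c N₁ N₂, hnf M = some (.node c N₁ N₂) := by
  rw [TAC.run] at h
  rcases hM : hnf M with _ | ⟨_ | _⟩ <;> simp_all

theorem TAC.run_isSome (A : TAC S0 S2 Q) (x : List Dir) : ∀ (M : Term S0 S2 [] .o) (q : Q),
    (A.run M q x).isSome ↔ (bohmTree M x).isSome := by
  induction x with
  | nil =>
    intro M q
    rw [TAC.run]
    exact iff_of_true rfl (bohmTree_nil_isSome M)
  | cons i x ih =>
    intro M q
    by_cases h : ∃ c N₁ N₂, hnf M = some (.node c N₁ N₂)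
    · obtain ⟨c, N₁, N₂, h⟩ := h
      rw [run_cons h, bohmTree_cons h]
      exact ih _ _
    · exact iff_of_false (fun h' => h (exists_hnf_of_run_cons h'))
        (fun h' => h (exists_hnf_of_bohmTree_cons h'))

/-- Below every address, the run continues as the run on the Böhm tree of a term whose value
contains the state at that address. -/
theorem TAC.exists_run_append {A : TAC S0 S2 Q} {x : List Dir} :
    ∀ {M : Term S0 S2 [] .o} {q p : Q}, M.UndefFree → q ∈ A.states M → A.run M q x = some p →
      ∃ N : Term S0 S2 [] .o, N.UndefFree ∧ p ∈ A.states N ∧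
        ∀ y, bohmTree M (x ++ y) = bohmTree N y ∧ A.run M q (x ++ y) = A.run N p y := by
  induction x with
  | nil =>
    intro M q p hM hq h
    rw [TAC.run] at h
    cases h
    exact ⟨M, hM, hq, fun _ => ⟨rfl, rfl⟩⟩
  | cons i x ih =>
    intro M q p hM hq h
    obtain ⟨c, N₁, N₂, hc⟩ := exists_hnf_of_run_cons (Option.isSome_iff_exists.2 ⟨p, h⟩)
    rw [run_cons hc] at h
    have hN := undefFree_of_hnf_eq_node hM hc
    have hs := choice_spec hc hq
    obtain ⟨N, hN, hp, hy⟩ := ih (M := i.pick (N₁, N₂)) (by cases i; exacts [hN.1, hN.2])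
      (by cases i; exacts [hs.2.1, hs.2.2]) h
    refine ⟨N, hN, hp, fun y => ?_⟩
    rw [List.cons_append, bohmTree_cons hc, run_cons hc]
    exact hy y

theorem TAC.acceptingRun_run {A : TAC S0 S2 Q} {M : Term S0 S2 [] .o} {q : Q} (hM : M.UndefFree)
    (hq : q ∈ A.states M) : A.AcceptingRun (bohmTree M) q (A.run M q) := by
  refine ⟨⟨fun x => A.run_isSome x M q, by rw [TAC.run], ?_⟩, ?_⟩
  · intro x c p p₁ p₂ hx hp h₁ h₂
    obtain ⟨N, hN, hpN, hy⟩ := exists_run_append hM hq hp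
    rw [← x.append_nil, (hy _).1, bohmTree_nil_eq_node] at hx
    obtain ⟨N₁, N₂, hc⟩ := hx
    rw [(hy _).2, run_cons hc, TAC.run] at h₁ h₂
    cases h₁
    cases h₂
    exact (choice_spec hc hpN).1
  · intro x c p hx hp
    obtain ⟨N, hN, hpN, hy⟩ := exists_run_append hM hq hp
    rw [← x.append_nil, (hy _).1, bohmTree] at hx
    rcases hc : hnf N with _ | ⟨d | ⟨d, N₁, N₂⟩⟩ <;> rw [hc] at hx <;> cases hx
    · exact leafOk_none_of_mem_states hN hc hpN
    · exact leafOk_some_of_mem_states hc hpN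

theorem TAC.bohmTree_mem_language_iff (A : TAC S0 S2 Q) {M : Term S0 S2 [] .o} (hM : M.UndefFree) :
    bohmTree M ∈ A.language ↔ A.init ∈ second A.divStates (A.value M) := by
  constructor
  · rintro ⟨-, r, hr, hacc⟩
    exact (covers_value A hM).2 _ (TAC.AcceptingRun.accepts (r := r) ⟨hr, hacc⟩)
  · intro h
    obtain ⟨hr, hacc⟩ := acceptingRun_run hM h
    exact ⟨isTree_bohmTree M, _, hr, hacc⟩

end Runs

end LambdaY

theorem mainTheorem1 {S0 : Type*} {S2 : Type*} {Q : Type*} [Finite Q]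
    (A : LambdaY.TAC S0 S2 Q) :
    (∀ a : LambdaY.Ty, Finite (LambdaY.K A.divStates a)) ∧
    ∀ M : LambdaY.Term S0 S2 [] LambdaY.Ty.o, M.UndefFree →
      (LambdaY.bohmTree M ∈ A.language ↔ A.init ∈ LambdaY.second A.divStates (A.value M)) := by
  exact ⟨fun a => inferInstance, fun _ hM => A.bohmTree_mem_language_iff hM⟩
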